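/- Let $A=A_{\bar 0}\oplus A_{\bar 1}$ be a supercommutative superalgebra over a field $K$ of characteristic $0$, with an odd $K$-linear superderivation $\mathcal{D}$ (so $\mathcal{D}$ exchanges parities and $\mathcal{D}(ab)=(\mathcal{D}a)b+(-1)^{|a|}a(\mathcal{D}b)$), and put $\partial=\mathcal{D}^2$; for example, superfields on the $(1|1)$ superspace with coordinates $(x,\theta)$ and $\mathcal{D}=\partial_\theta+\theta\partial_x$. A super-pseudodifferential operator is a formal series $P=\sum_{i\le N}a_i\mathcal{D}^i$ with $N\in\mathbb{Z}$ and $a_i\in A$; these are multiplied by means of the rule, valid for all $n\in\mathbb{Z}$ and homogeneous $a\in A$, $$\mathcal{D}^n a=\sum_{k\ge 0}{n \brack k}(-1)^{|a|(n-k)}(\mathcal{D}^k a)\,\mathcal{D}^{n-k},\qquad {n\brack k}=\begin{cases}0,& n \text{ even},\ k\text{ odd},\\ \binom{\lfloor n/2\rfloor}{\lfloor k/2\rfloor},&\text{otherwise.}\end{cases}$$ The super residue is $\mathrm{sres}\,P=a_{-1}$. Let $\phi\in A_{\bar 1}$ be odd and let $$L=(\mathcal{D}^3+\phi)(\mathcal{D}^3+\phi)=(\mathcal{D}^3+\phi)^2$$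 be the Lax operator of the supersymmetric Sawada--Kotera equation. Then there is exactly one super-pseudodifferential operator $L^{1/3}$ of the form $\partial+(\text{lower order terms})$ whose cube is $L$, and, with $L^{n/3}:=(L^{1/3})^n$, for every integer $n\ge 0$ $$\mathrm{sres}\,L^{n/3}\in\mathrm{Im}\,\mathcal{D}.$$ More precisely, $\mathrm{sres}\,L^{n/3}=\mathcal{D}g$ for some differential polynomial $g$ in $\phi$, that is, some $g$ in the $K$-subalgebra of $A$ generated by $\phi,\mathcal{D}\phi,\mathcal{D}^2\phi,\dots$ (So the conserved densities $\mathrm{sres}\,L^{n/3}$ are total super derivatives, hence trivial.) -/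

import Mathlib

namespace SuperSK

section Superalgebra

variable {K A : Type*} [Field K] [Ring A] [Algebra K A]

/-- Supercommutativity of a `ZMod 2`-graded algebra (`𝒜 0` even part, `𝒜 1` odd part):
even elements are central and odd elements anticommute with each other. -/
structure IsSupercommutative (𝒜 : ZMod 2 → Submodule K A) : Prop where
  even_comm : ∀ a ∈ 𝒜 0, ∀ b : A, a * b = b * a
  odd_anticomm : ∀ a ∈ 𝒜 1, ∀ b ∈ 𝒜 1, a * b = -(b * a)

/-- `twist 𝒜 n a = (-1) ^ (n * |a|) a` on homogeneous `a`, extended linearly. -/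
noncomputable def twist (𝒜 : ZMod 2 → Submodule K A) [GradedAlgebra 𝒜] (n : ℤ) (a : A) : A :=
  (DirectSum.decompose 𝒜 a 0 : A)
    + ((n.negOnePow : ℤˣ) : ℤ) • (DirectSum.decompose 𝒜 a 1 : A)

/-- An odd superderivation: it exchanges the even and the odd part, and
`D (a * b) = D a * b + (-1) ^ |a| a * D b`. -/
structure OddDerivation (𝒜 : ZMod 2 → Submodule K A) [GradedAlgebra 𝒜] extends A →ₗ[K] A where
  map_mem' : ∀ (i : ZMod 2), ∀ a ∈ 𝒜 i, toFun a ∈ 𝒜 (i + 1)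
  leibniz' : ∀ a b : A, toFun (a * b) = toFun a * b + twist 𝒜 1 a * toFun b

instance (𝒜 : ZMod 2 → Submodule K A) [GradedAlgebra 𝒜] :
    CoeFun (OddDerivation 𝒜) (fun _ => A → A) :=
  ⟨fun D => D.toLinearMap⟩

/-- The algebra of differential polynomials in `φ`: polynomial expressions, with scalar
coefficients, in `φ, D φ, D² φ, …`. -/
def diffPoly {𝒜 : ZMod 2 → Submodule K A} [GradedAlgebra 𝒜] (D : OddDerivation 𝒜) (φ : A) :
    Subalgebra K A :=
  Algebra.adjoin K (Set.range fun k : ℕ => (D : A → A)^[k] φ)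

end Superalgebra

/-- The super binomial coefficient `[n; k]` for `n : ℤ`, `k : ℕ`: it vanishes when `n` is even and
`k` is odd, and is the binomial coefficient of `⌊n/2⌋` over `⌊k/2⌋` otherwise. -/
def superBinom (n : ℤ) (k : ℕ) : ℤ :=
  if Even n ∧ Odd k then 0 else Ring.choose (n / 2) (k / 2)

/-- Super-pseudodifferential operators `∑_{i ≤ N} a_i 𝒟^i` with coefficients on the left. -/
@[ext]
structure SuperPsiDO {K A : Type*} [Field K] [Ring A] [Algebra K A]
    {𝒜 : ZMod 2 → Submodule K A} [GradedAlgebra 𝒜] (D : OddDerivation 𝒜) where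
  coeff : ℤ → A
  bounded' : ∃ N : ℤ, ∀ i, N < i → coeff i = 0

namespace SuperPsiDO

variable {K A : Type*} [Field K] [Ring A] [Algebra K A]
  {𝒜 : ZMod 2 → Submodule K A} [GradedAlgebra 𝒜] {D : OddDerivation 𝒜}

/-- The monomial `a 𝒟^i`. -/
def monomial (D : OddDerivation 𝒜) (i : ℤ) (a : A) : SuperPsiDO D where
  coeff j := if j = i then a else 0
  bounded' := ⟨i, fun _ hj => if_neg hj.ne'⟩

instance : One (SuperPsiDO D) := ⟨monomial D 0 1⟩

instance : Add (SuperPsiDO D) where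
  add P Q :=
    { coeff := fun i => P.coeff i + Q.coeff i
      bounded' := by
        obtain ⟨N, hN⟩ := P.bounded'
        obtain ⟨M, hM⟩ := Q.bounded'
        refine ⟨max N M, fun i hi => ?_⟩
        rw [hN i (lt_of_le_of_lt (le_max_left _ _) hi),
          hM i (lt_of_le_of_lt (le_max_right _ _) hi), add_zero] }

@[simp]
theorem twist_zero (n : ℤ) : twist 𝒜 n 0 = 0 := by
  simp [twist]

@[simp]
theorem iterate_zero_apply (k : ℕ) : (D : A → A)^[k] 0 = 0 :=
  Function.iterate_fixed (map_zero D.toLinearMap) k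

/-- The contribution to the coefficient of `𝒟^m` in `P * Q` of the `k`-th term of
`𝒟^i b = ∑_k [i; k] (-1) ^ (|b| (i - k)) (𝒟^k b) 𝒟^(i - k)`,
where `i` is the exponent in `P` and `b` is the coefficient of `𝒟^(m - i + k)` in `Q`. -/
noncomputable def mulTerm (P Q : SuperPsiDO D) (m : ℤ) (p : ℤ × ℕ) : A :=
  superBinom p.1 p.2 •
    (P.coeff p.1 * (D : A → A)^[p.2] (twist 𝒜 (p.1 - p.2) (Q.coeff (m - p.1 + p.2))))

theorem mulTerm_eq_zero_of_left (P Q : SuperPsiDO D) (m : ℤ) (p : ℤ × ℕ)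
    (h : P.coeff p.1 = 0) : mulTerm P Q m p = 0 := by
  simp [mulTerm, h]

theorem mulTerm_eq_zero_of_right (P Q : SuperPsiDO D) (m : ℤ) (p : ℤ × ℕ)
    (h : Q.coeff (m - p.1 + p.2) = 0) : mulTerm P Q m p = 0 := by
  simp [mulTerm, h]

/-- The sum defining each coefficient of a product is finite. -/
theorem finite_support_mulTerm (P Q : SuperPsiDO D) (m : ℤ) :
    (Function.support (mulTerm P Q m)).Finite := by
  obtain ⟨N, hN⟩ := P.bounded'
  obtain ⟨M, hM⟩ := Q.bounded'
  refine ((Set.finite_Icc (m - M) N).prod (Set.finite_Iic (M - m + N).toNat)).subset ?_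
  rintro ⟨i, k⟩ h
  have h1 : i ≤ N := by
    by_contra hi
    exact h (mulTerm_eq_zero_of_left P Q m _ (hN i (not_le.mp hi)))
  have h2 : m - i + k ≤ M := by
    by_contra hi
    exact h (mulTerm_eq_zero_of_right P Q m _ (hM _ (not_le.mp hi)))
  simp only [Set.mem_prod, Set.mem_Icc, Set.mem_Iic]
  omega

noncomputable instance : Mul (SuperPsiDO D) where
  mul P Q :=
    { coeff := fun m => ∑ᶠ p : ℤ × ℕ, mulTerm P Q m p
      bounded' := by
        obtain ⟨N, hN⟩ := P.bounded'
        obtain ⟨M, hM⟩ := Q.bounded'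
        refine ⟨N + M, fun m hm => finsum_eq_zero_of_forall_eq_zero fun p => ?_⟩
        by_cases hp : N < p.1
        · exact mulTerm_eq_zero_of_left P Q m p (hN _ hp)
        · exact mulTerm_eq_zero_of_right P Q m p (hM _ (by omega)) }

noncomputable instance : Pow (SuperPsiDO D) ℕ := ⟨fun P n => npowRec n P⟩

/-- The super residue: the coefficient of `𝒟^(-1)`. -/
def sres (P : SuperPsiDO D) : A := P.coeff (-1)

/-- The Lax operator `L = (𝒟³ + φ)²`. -/
noncomputable def laxOperator (D : OddDerivation 𝒜) (φ : A) : SuperPsiDO D :=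
  (monomial D 3 1 + monomial D 0 φ) * (monomial D 3 1 + monomial D 0 φ)

/-- `Q = L^(1/3)` for an operator `L = ∂³ + ⋯`: `Q³ = L` and `Q = ∂ + (lower order terms)`,
where `∂ = 𝒟²`. -/
structure IsCubeRoot (Q L : SuperPsiDO D) : Prop where
  cube : Q ^ 3 = L
  leading : Q.coeff 2 = 1
  order_le : ∀ i, 2 < i → Q.coeff i = 0

end SuperPsiDO

end SuperSK

namespace SuperSK

/-! The operator `𝒟³ + φ` has an odd cube root `R = 𝒟 + ⋯`, whose coefficients are differential
polynomials in `φ` (`exists_odd_cube_root`). Since `L = (R³)² = (R²)³`, uniqueness of the cube root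
(`IsCubeRoot.eq`) gives `L^(1/3) = R²`. For `n ≥ 1`, `L^(n/3) = R · R^(2n-1) = R^(2n-1) · R` is
therefore half the supercommutator of two odd operators.

The residue of such a supercommutator lies in the image of `𝒟` (`exists_sres_supercommutator`). By
additivity it suffices to pair `S` with one monomial `a 𝒟^i`, and there the residue of `𝒟^i S a` is
computed in two ways: `a` comes out of the residue as a factor on the right, and moving `𝒟^i` past
the coefficients of `S a` costs only total derivatives.

Both cube root statements work order by order: changing a coefficient `e` of a candidate root
changes the top coefficient of the cube by `3e` for roots `𝒟² + ⋯`, and by `2e ± e` for roots `𝒟 +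
⋯`. These maps are invertible in characteristic `0`.

All of this needs the multiplication to be associative, which reduces to the compatibility of left
multiplication by `𝒟^i` with products (`dpow_mul`). -/

theorem mul_comm_of_mem {K A : Type*} [Field K] [Ring A] [Algebra K A]
    {𝒜 : ZMod 2 → Submodule K A} (hA : IsSupercommutative 𝒜) {p : ZMod 2} {a b : A}
    (ha : a ∈ 𝒜 (1 + p)) (hb : b ∈ 𝒜 p) : a * b = b * a := by
  fin_cases p
  · exact (hA.even_comm b hb a).symm
  · exact hA.even_comm a ha b

/-! ### The parity automorphism and odd derivations -/

section Twist

variable {K A : Type*} [Field K] [Ring A] [Algebra K A]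
  {𝒜 : ZMod 2 → Submodule K A} [GradedAlgebra 𝒜]

theorem twist_of_mem_zero (n : ℤ) {a : A} (ha : a ∈ 𝒜 0) : twist 𝒜 n a = a := by
  rw [twist, DirectSum.decompose_of_mem_same 𝒜 ha,
    DirectSum.decompose_of_mem_ne 𝒜 ha (by decide : (0 : ZMod 2) ≠ 1), smul_zero, add_zero]

theorem twist_of_mem_one (n : ℤ) {a : A} (ha : a ∈ 𝒜 1) :
    twist 𝒜 n a = ((n.negOnePow : ℤˣ) : ℤ) • a := by
  rw [twist, DirectSum.decompose_of_mem_same 𝒜 ha,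
    DirectSum.decompose_of_mem_ne 𝒜 ha (by decide : (1 : ZMod 2) ≠ 0), zero_add]

theorem twist_add (n : ℤ) (a b : A) : twist 𝒜 n (a + b) = twist 𝒜 n a + twist 𝒜 n b := by
  simp only [twist, DirectSum.decompose_add, DirectSum.add_apply, Submodule.coe_add, smul_add]
  abel

theorem twist_smul (n : ℤ) (c : K) (a : A) : twist 𝒜 n (c • a) = c • twist 𝒜 n a := by
  simp only [twist, DirectSum.decompose_smul, DirectSum.smul_apply, Submodule.coe_smul, smul_add]
  rw [smul_comm]

/-- The parity automorphism `twist 𝒜 n` as a linear map. -/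
noncomputable def twistLinear (𝒜 : ZMod 2 → Submodule K A) [GradedAlgebra 𝒜] (n : ℤ) :
    A →ₗ[K] A where
  toFun := twist 𝒜 n
  map_add' := twist_add n
  map_smul' := twist_smul n

@[simp]
theorem twistLinear_apply (n : ℤ) (a : A) : twistLinear 𝒜 n a = twist 𝒜 n a := rfl

theorem twist_sum {ι : Type*} (n : ℤ) (s : Finset ι) (f : ι → A) :
    twist 𝒜 n (∑ i ∈ s, f i) = ∑ i ∈ s, twist 𝒜 n (f i) :=
  map_sum (twistLinear 𝒜 n) f s

theorem twist_zsmul (n c : ℤ) (a : A) : twist 𝒜 n (c • a) = c • twist 𝒜 n a :=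
  map_zsmul (twistLinear 𝒜 n) c a

theorem exists_even_add_odd (𝒜 : ZMod 2 → Submodule K A) [GradedAlgebra 𝒜] (a : A) :
    ∃ a₀ ∈ 𝒜 0, ∃ a₁ ∈ 𝒜 1, a = a₀ + a₁ := by
  classical
  refine ⟨_, (DirectSum.decompose 𝒜 a 0).2, _, (DirectSum.decompose 𝒜 a 1).2, ?_⟩
  have h := DirectSum.sum_support_decompose 𝒜 a
  rw [Finset.sum_subset (Finset.subset_univ _) fun i _ hi => by
    simpa using hi] at h
  exact h.symm.trans (Fin.sum_univ_two _)

theorem twist_mem {p : ZMod 2} (n : ℤ) {a : A} (ha : a ∈ 𝒜 p) : twist 𝒜 n a ∈ 𝒜 p := by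
  fin_cases p
  · exact (twist_of_mem_zero n ha).symm ▸ ha
  · exact (twist_of_mem_one n ha).symm ▸ zsmul_mem ha _

theorem one_mem_even : (1 : A) ∈ 𝒜 0 := SetLike.GradedOne.one_mem

@[simp]
theorem twist_one_right (n : ℤ) : twist 𝒜 n (1 : A) = 1 :=
  twist_of_mem_zero n one_mem_even

theorem twist_zero_left (a : A) : twist 𝒜 0 a = a := by
  obtain ⟨a₀, h₀, a₁, h₁, rfl⟩ := exists_even_add_odd 𝒜 a
  simp [twist_add, twist_of_mem_zero _ h₀, twist_of_mem_one _ h₁]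

theorem twist_twist (m n : ℤ) (a : A) : twist 𝒜 m (twist 𝒜 n a) = twist 𝒜 (m + n) a := by
  obtain ⟨a₀, h₀, a₁, h₁, rfl⟩ := exists_even_add_odd 𝒜 a
  simp only [twist_add, twist_of_mem_zero _ h₀, twist_of_mem_one _ h₁, twist_zsmul,
    Int.negOnePow_add, Units.val_mul, smul_smul]
  rw [mul_comm]

theorem twist_of_even {n : ℤ} (hn : Even n) (a : A) : twist 𝒜 n a = a := by
  obtain ⟨a₀, h₀, a₁, h₁, rfl⟩ := exists_even_add_odd 𝒜 a
  simp [twist_add, twist_of_mem_zero _ h₀, twist_of_mem_one _ h₁, Int.negOnePow_even n hn]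

theorem twist_mul (n : ℤ) (a b : A) : twist 𝒜 n (a * b) = twist 𝒜 n a * twist 𝒜 n b := by
  obtain ⟨a₀, h₀, a₁, h₁, rfl⟩ := exists_even_add_odd 𝒜 a
  obtain ⟨b₀, k₀, b₁, k₁, rfl⟩ := exists_even_add_odd 𝒜 b
  have h00 : a₀ * b₀ ∈ 𝒜 0 := SetLike.mul_mem_graded h₀ k₀
  have h01 : a₀ * b₁ ∈ 𝒜 1 := by simpa using SetLike.mul_mem_graded h₀ k₁
  have h10 : a₁ * b₀ ∈ 𝒜 1 := by simpa using SetLike.mul_mem_graded h₁ k₀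
  have h11 : a₁ * b₁ ∈ 𝒜 0 := SetLike.mul_mem_graded h₁ k₁
  have hs : ((n.negOnePow : ℤˣ) : ℤ) * ((n.negOnePow : ℤˣ) : ℤ) = 1 := by
    rw [← Units.val_mul, Int.units_mul_self, Units.val_one]
  simp only [twist_add, mul_add, add_mul, twist_of_mem_zero _ h₀, twist_of_mem_one _ h₁,
    twist_of_mem_zero _ k₀, twist_of_mem_one _ k₁, twist_of_mem_zero _ h00,
    twist_of_mem_one _ h01, twist_of_mem_one _ h10, twist_of_mem_zero _ h11,
    smul_mul_assoc, mul_smul_comm, smul_add, smul_smul, hs, one_smul]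

namespace OddDerivation

variable (D : OddDerivation 𝒜)

theorem map_mem {p : ZMod 2} {a : A} (ha : a ∈ 𝒜 p) : D a ∈ 𝒜 (p + 1) := D.map_mem' p a ha

theorem iterate_mem (k : ℕ) {p : ZMod 2} {a : A} (ha : a ∈ 𝒜 p) :
    (D : A → A)^[k] a ∈ 𝒜 (p + k) := by
  induction k with
  | zero => simpa using ha
  | succ k ih =>
    rw [Function.iterate_succ_apply', Nat.cast_succ, ← add_assoc]
    exact D.map_mem ih

theorem leibniz (a b : A) : D (a * b) = D a * b + twist 𝒜 1 a * D b := D.leibniz' a b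

theorem map_one : D 1 = 0 := by
  simpa using D.leibniz 1 1

theorem twist_map (n : ℤ) (a : A) :
    twist 𝒜 n (D a) = ((n.negOnePow : ℤˣ) : ℤ) • D (twist 𝒜 n a) := by
  obtain ⟨a₀, h₀, a₁, h₁, rfl⟩ := exists_even_add_odd 𝒜 a
  have k₀ : D a₀ ∈ 𝒜 1 := by simpa using D.map_mem h₀
  have k₁ : D a₁ ∈ 𝒜 0 := D.map_mem h₁
  have hs : ((n.negOnePow : ℤˣ) : ℤ) * ((n.negOnePow : ℤˣ) : ℤ) = 1 := by
    rw [← Units.val_mul, Int.units_mul_self, Units.val_one]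
  simp only [twist_add, map_add, twist_of_mem_zero _ h₀, twist_of_mem_one _ h₁,
    twist_of_mem_one _ k₀, twist_of_mem_zero _ k₁, map_zsmul, smul_add, smul_smul, hs, one_smul]

theorem twist_one_iterate (k : ℕ) (a : A) :
    twist 𝒜 1 ((D : A → A)^[k] a) = (-1 : ℤ) ^ k • (D : A → A)^[k] (twist 𝒜 1 a) := by
  induction k with
  | zero => simp
  | succ k ih =>
    rw [Function.iterate_succ_apply', twist_map, ih, Function.iterate_succ_apply', map_zsmul,
      smul_smul, Int.negOnePow_one, Units.val_neg, Units.val_one, pow_succ']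

end OddDerivation

end Twist

/-! ### Super binomial coefficients -/

theorem superBinom_zero_right (n : ℤ) : superBinom n 0 = 1 := by
  simp [superBinom]

/-- The super Pascal rule behind `𝒟^(n+1) = 𝒟 𝒟^n`; the sign arises when the parity automorphism
passes `k + 1` odd derivations. -/
theorem superBinom_succ_succ (n : ℤ) (k : ℕ) :
    superBinom (n + 1) (k + 1) = (-1) ^ (k + 1) * superBinom n (k + 1) + superBinom n k := by
  have ea (a : ℤ) : ¬Odd (2 * a) := Int.not_odd_iff_even.2 (even_two_mul a)
  have eb (b : ℕ) : ¬Odd (2 * b) := Nat.not_odd_iff_even.2 (even_two_mul b)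
  rcases Int.even_or_odd' n with ⟨a, rfl | rfl⟩ <;> rcases Nat.even_or_odd' k with ⟨b, rfl | rfl⟩
  · have h1 : (2 * a + 1) / 2 = a := by omega
    have h2 : (2 * b + 1) / 2 = b := by omega
    simp [superBinom, h1, h2, ea, eb, parity_simps]
  · have h1 : (2 * a + 1) / 2 = a := by omega
    have h2 : (2 * b + 1 + 1) / 2 = b + 1 := by omega
    simp [superBinom, h1, h2, ea, parity_simps, pow_succ]
  · have h1 : (2 * a + 1) / 2 = a := by omega
    have h2 : (2 * b + 1) / 2 = b := by omega
    simp [superBinom, h1, h2, ea, parity_simps, pow_succ]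
  · have h1 : (2 * a + 1) / 2 = a := by omega
    have h2 : (2 * b + 1 + 1) / 2 = b + 1 := by omega
    have h3 : (2 * a + 1 + 1) / 2 = a + 1 := by omega
    have h4 : (2 * b + 1) / 2 = b := by omega
    simp [superBinom, h1, h2, h3, h4, ea, parity_simps, pow_succ, Ring.choose_succ_succ]
    exact add_comm _ _

/-- For `n ≥ 0`, this says that `𝒟^n a` has no `𝒟^(-1)` term. -/
theorem superBinom_natCast_succ (n : ℕ) : superBinom n (n + 1) = 0 := by
  rcases Nat.even_or_odd' n with ⟨b, rfl | rfl⟩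
  · simp [superBinom, parity_simps]
  · have h1 : ((2 * b + 1 : ℕ) : ℤ) / 2 = (b : ℕ) := by omega
    have h2 : (2 * b + 1 + 1) / 2 = b + 1 := by omega
    rw [superBinom, h1, h2, Ring.choose_natCast]
    simp

theorem superBinom_zero_left (k : ℕ) : superBinom 0 (k + 1) = 0 := by
  rcases Nat.even_or_odd' k with ⟨b, rfl | rfl⟩
  · simp [superBinom, parity_simps]
  · have h2 : (2 * b + 1 + 1) / 2 = b + 1 := by omega
    simp [superBinom, h2, Ring.choose_zero_succ]

end SuperSK

/-! ### The ring of super-pseudodifferential operators -/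

namespace SuperSK

namespace SuperPsiDO

open Finset

variable {K A : Type*} [Field K] [Ring A] [Algebra K A]
  {𝒜 : ZMod 2 → Submodule K A} [GradedAlgebra 𝒜] {D : OddDerivation 𝒜}

/-- `P` has order at most `N`. -/
def OrderLE (P : SuperPsiDO D) (N : ℤ) : Prop := ∀ i, N < i → P.coeff i = 0

theorem OrderLE.mono {P : SuperPsiDO D} {M N : ℤ} (h : P.OrderLE M) (hMN : M ≤ N) :
    P.OrderLE N := fun i hi => h i (hMN.trans_lt hi)

theorem exists_orderLE (P : SuperPsiDO D) : ∃ N, P.OrderLE N := P.bounded'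

/-- The coefficients of `𝒟^i Q`. -/
noncomputable def dpowCoeff (i : ℤ) (Q : SuperPsiDO D) (m : ℤ) : A :=
  ∑ᶠ k : ℕ, superBinom i k • (D : A → A)^[k] (twist 𝒜 (i - k) (Q.coeff (m - i + k)))

theorem dpowCoeff_eq_sum {Q : SuperPsiDO D} {M : ℤ} (hQ : Q.OrderLE M) {i m : ℤ} {n : ℕ}
    (hn : M - m + i < n) :
    dpowCoeff i Q m = ∑ k ∈ range n,
      superBinom i k • (D : A → A)^[k] (twist 𝒜 (i - k) (Q.coeff (m - i + k))) := by
  refine finsum_eq_sum_of_support_subset _ fun k hk => ?_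
  by_contra hkn
  rw [coe_range, Set.mem_Iio] at hkn
  refine hk ?_
  beta_reduce
  rw [hQ _ (by omega), twist_zero, iterate_zero_apply, smul_zero]

theorem dpowCoeff_eq_zero {Q : SuperPsiDO D} {M : ℤ} (hQ : Q.OrderLE M) {i m : ℤ}
    (h : i + M < m) : dpowCoeff i Q m = 0 := by
  rw [dpowCoeff_eq_sum hQ (n := 0) (by push_cast; omega), sum_range_zero]

theorem dpowCoeff_top {Q : SuperPsiDO D} {M : ℤ} (hQ : Q.OrderLE M) (i : ℤ) :
    dpowCoeff i Q (i + M) = twist 𝒜 i (Q.coeff M) := by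
  rw [dpowCoeff_eq_sum hQ (n := 1) (by push_cast; omega), sum_range_one]
  simp [superBinom_zero_right]

/-- The operator `𝒟^i Q`. -/
noncomputable def dpow (i : ℤ) (Q : SuperPsiDO D) : SuperPsiDO D where
  coeff := dpowCoeff i Q
  bounded' := by
    obtain ⟨M, hM⟩ := Q.exists_orderLE
    exact ⟨i + M, fun m hm => dpowCoeff_eq_zero hM hm⟩

theorem OrderLE.dpow {Q : SuperPsiDO D} {M : ℤ} (hQ : Q.OrderLE M) (i : ℤ) :
    (dpow i Q).OrderLE (i + M) := fun _ hm => dpowCoeff_eq_zero hQ hm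

theorem dpow_zero (Q : SuperPsiDO D) : dpow 0 Q = Q := by
  ext m
  obtain ⟨M, hM⟩ := Q.exists_orderLE
  change dpowCoeff 0 Q m = _
  rw [dpowCoeff_eq_sum hM (n := (M - m + 0).toNat + 1) (by omega), sum_range_succ',
    sum_eq_zero fun k _ => by rw [superBinom_zero_left, zero_smul]]
  simp [superBinom_zero_right, twist_zero_left]

theorem dpow_add_one_coeff (i : ℤ) (Q : SuperPsiDO D) (m : ℤ) :
    (dpow (i + 1) Q).coeff m =
      twist 𝒜 1 ((dpow i Q).coeff (m - 1)) + D ((dpow i Q).coeff m) := by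
  obtain ⟨M, hM⟩ := Q.exists_orderLE
  change dpowCoeff (i + 1) Q m = twist 𝒜 1 (dpowCoeff i Q (m - 1)) + D (dpowCoeff i Q m)
  have hn : M - m + i + 1 < ((M - m + i + 1).toNat + 1 : ℕ) := by push_cast; omega
  set n := (M - m + i + 1).toNat + 1
  rw [dpowCoeff_eq_sum hM (n := n + 1) (by push_cast; omega),
    dpowCoeff_eq_sum hM (n := n + 1) (m := m - 1) (by push_cast; omega),
    dpowCoeff_eq_sum hM (n := n) (by omega), twist_sum, map_sum, sum_range_succ',
    sum_range_succ' _ n, add_right_comm, ← sum_add_distrib]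
  congr 1
  · refine sum_congr rfl fun k _ => ?_
    have e1 : m - (i + 1) + ((k + 1 : ℕ) : ℤ) = m - i + k := by push_cast; ring
    have e2 : m - 1 - i + ((k + 1 : ℕ) : ℤ) = m - i + k := by push_cast; ring
    have e3 : i + 1 - ((k + 1 : ℕ) : ℤ) = i - k := by push_cast; ring
    have e4 : 1 + (i - ((k + 1 : ℕ) : ℤ)) = i - k := by push_cast; ring
    rw [e1, e2, e3, twist_zsmul, D.twist_one_iterate, twist_twist, e4, map_zsmul,
      ← Function.iterate_succ_apply' (f := (D : A → A)), smul_smul, ← add_smul,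
      superBinom_succ_succ,
      mul_comm (superBinom i (k + 1))]
  · simp [superBinom_zero_right, twist_twist, add_comm, sub_right_comm, sub_add_eq_sub_sub]

theorem add_coeff (P Q : SuperPsiDO D) (i : ℤ) : (P + Q).coeff i = P.coeff i + Q.coeff i := rfl

/-- The window `s` is left free so that sums coming from different products can be given a common
index set. -/
theorem mul_coeff {P Q : SuperPsiDO D} {N M : ℤ} (hP : P.OrderLE N) (hQ : Q.OrderLE M) {m : ℤ}
    {s : Finset ℤ} (hs : Icc (m - M) N ⊆ s) :
    (P * Q).coeff m = ∑ i ∈ s, P.coeff i * (dpow i Q).coeff m := by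
  change ∑ᶠ p : ℤ × ℕ, mulTerm P Q m p = _
  have hsup : Function.support (mulTerm P Q m) ⊆
      (Icc (m - M) N ×ˢ range ((M - m + N).toNat + 1) : Finset (ℤ × ℕ)) := by
    rintro ⟨i, k⟩ h
    have h1 : i ≤ N := by
      by_contra hi
      exact h (mulTerm_eq_zero_of_left P Q m _ (hP i (not_le.mp hi)))
    have h2 : m - i + k ≤ M := by
      by_contra hi
      exact h (mulTerm_eq_zero_of_right P Q m _ (hQ _ (not_le.mp hi)))
    simp only [coe_product, Set.mem_prod, coe_Icc, Set.mem_Icc, coe_range, Set.mem_Iio]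
    omega
  rw [finsum_eq_sum_of_support_subset _ hsup, sum_product, ← sum_subset hs]
  · refine sum_congr rfl fun i hi => ?_
    rw [mem_Icc] at hi
    change _ = _ * dpowCoeff i Q m
    rw [dpowCoeff_eq_sum hQ (n := (M - m + N).toNat + 1) (by push_cast; omega), mul_sum]
    exact sum_congr rfl fun k _ => (mul_smul_comm _ _ _).symm
  · intro i _ hi
    by_cases h : N < i
    · rw [hP i h, zero_mul]
    · rw [hQ.dpow i m (by rw [mem_Icc] at hi; omega), mul_zero]

theorem OrderLE.mul {P Q : SuperPsiDO D} {N M : ℤ} (hP : P.OrderLE N) (hQ : Q.OrderLE M) :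
    (P * Q).OrderLE (N + M) := fun m hm => by
  rw [mul_coeff hP hQ (s := ∅) (by rw [Icc_eq_empty (by omega)]), sum_empty]

theorem mul_coeff_top {P Q : SuperPsiDO D} {N M : ℤ} (hP : P.OrderLE N) (hQ : Q.OrderLE M) :
    (P * Q).coeff (N + M) = P.coeff N * twist 𝒜 N (Q.coeff M) := by
  rw [mul_coeff hP hQ (s := {N}) (by rw [add_sub_cancel_right, Icc_self]), sum_singleton]
  congr 1
  exact dpowCoeff_top hQ N

theorem monomial_coeff (i : ℤ) (a : A) (j : ℤ) :
    (monomial D i a).coeff j = if j = i then a else 0 := rfl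

theorem orderLE_monomial (i : ℤ) (a : A) : (monomial D i a).OrderLE i :=
  fun _ hj => if_neg hj.ne'

theorem monomial_mul_coeff (i : ℤ) (a : A) (Q : SuperPsiDO D) (m : ℤ) :
    (monomial D i a * Q).coeff m = a * (dpow i Q).coeff m := by
  obtain ⟨M, hM⟩ := Q.exists_orderLE
  rw [mul_coeff (orderLE_monomial i a) hM (s := insert i (Icc (m - M) i)) (subset_insert _ _),
    sum_eq_single i]
  · rw [monomial_coeff, if_pos rfl]
  · intro j _ hj
    rw [monomial_coeff, if_neg hj, zero_mul]
  · exact fun h => (h (mem_insert_self _ _)).elim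

theorem monomial_one_mul (i : ℤ) (Q : SuperPsiDO D) : monomial D i 1 * Q = dpow i Q := by
  ext m
  rw [monomial_mul_coeff, one_mul]

theorem OrderLE.add {P Q : SuperPsiDO D} {N : ℤ} (hP : P.OrderLE N) (hQ : Q.OrderLE N) :
    (P + Q).OrderLE N := fun i hi => by rw [add_coeff, hP i hi, hQ i hi, add_zero]

theorem exists_common_orderLE (P Q : SuperPsiDO D) : ∃ N, P.OrderLE N ∧ Q.OrderLE N := by
  obtain ⟨N, hN⟩ := P.exists_orderLE
  obtain ⟨M, hM⟩ := Q.exists_orderLE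
  exact ⟨max N M, hN.mono (le_max_left _ _), hM.mono (le_max_right _ _)⟩

protected theorem add_mul (P Q R : SuperPsiDO D) : (P + Q) * R = P * R + Q * R := by
  ext m
  obtain ⟨N, hP, hQ⟩ := exists_common_orderLE P Q
  obtain ⟨M, hR⟩ := R.exists_orderLE
  rw [add_coeff, mul_coeff hP hR subset_rfl, mul_coeff hQ hR subset_rfl,
    mul_coeff (hP.add hQ) hR subset_rfl, ← sum_add_distrib]
  exact sum_congr rfl fun i _ => add_mul _ _ _

theorem dpow_add (i : ℤ) (P Q : SuperPsiDO D) : dpow i (P + Q) = dpow i P + dpow i Q := by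
  ext m
  obtain ⟨N, hP, hQ⟩ := exists_common_orderLE P Q
  have hn : N - m + i < ((N - m + i).toNat + 1 : ℕ) := by push_cast; omega
  change dpowCoeff i (P + Q) m = dpowCoeff i P m + dpowCoeff i Q m
  rw [dpowCoeff_eq_sum hP hn, dpowCoeff_eq_sum hQ hn, dpowCoeff_eq_sum (hP.add hQ) hn,
    ← sum_add_distrib]
  refine sum_congr rfl fun k _ => ?_
  rw [add_coeff, twist_add, iterate_map_add, smul_add]

protected theorem mul_add (P Q R : SuperPsiDO D) : P * (Q + R) = P * Q + P * R := by
  ext m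
  obtain ⟨N, hP⟩ := P.exists_orderLE
  obtain ⟨M, hQ, hR⟩ := exists_common_orderLE Q R
  rw [add_coeff, mul_coeff hP hQ subset_rfl, mul_coeff hP hR subset_rfl,
    mul_coeff hP (hQ.add hR) subset_rfl, ← sum_add_distrib]
  refine sum_congr rfl fun i _ => ?_
  rw [dpow_add, add_coeff, mul_add]

theorem dpow_one_coeff (Q : SuperPsiDO D) (m : ℤ) :
    (dpow 1 Q).coeff m = twist 𝒜 1 (Q.coeff (m - 1)) + D (Q.coeff m) := by
  have h := dpow_add_one_coeff 0 Q m
  rwa [zero_add, dpow_zero] at h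

theorem dpow_add_one (i : ℤ) (Q : SuperPsiDO D) : dpow (i + 1) Q = dpow 1 (dpow i Q) := by
  ext m
  rw [dpow_add_one_coeff, dpow_one_coeff]

/-- The coefficients of `P` are recovered from those of `𝒟 P` from the top down, because the parity
automorphism is invertible. -/
theorem dpow_one_injective : Function.Injective (dpow 1 : SuperPsiDO D → SuperPsiDO D) := by
  intro P Q h
  obtain ⟨N, hP, hQ⟩ := exists_common_orderLE P Q
  have key (n : ℕ) : P.coeff (N + 1 - n) = Q.coeff (N + 1 - n) := by
    induction n with
    | zero => rw [hP _ (by simp), hQ _ (by simp)]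
    | succ n ih =>
      have hm := congrArg (fun S => coeff S (N + 1 - n)) h
      simp only [dpow_one_coeff, ih, add_left_inj] at hm
      have hs := congrArg (twist 𝒜 (-1)) hm
      rw [twist_twist, twist_twist, neg_add_cancel, twist_zero_left, twist_zero_left] at hs
      rwa [Nat.cast_succ, ← sub_sub]
  ext i
  rcases le_or_gt i N with hi | hi
  · obtain ⟨n, rfl⟩ : ∃ n : ℕ, i = N + 1 - n := ⟨(N + 1 - i).toNat, by omega⟩
    exact key n
  · rw [hP i hi, hQ i hi]

/-- Split `𝒟 Q` into the shifted twist of `Q` and the coefficientwise derivative of `Q`; the super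
Leibniz rule matches the terms. -/
theorem dpow_one_mul (Q R : SuperPsiDO D) : dpow 1 (Q * R) = dpow 1 Q * R := by
  obtain ⟨N, hQ⟩ := Q.exists_orderLE
  obtain ⟨M, hR⟩ := R.exists_orderLE
  obtain ⟨Q₁, hQ₁⟩ : ∃ P : SuperPsiDO D, ∀ i, P.coeff i = twist 𝒜 1 (Q.coeff (i - 1)) :=
    ⟨⟨fun i => twist 𝒜 1 (Q.coeff (i - 1)), N + 1, fun i hi => by
      rw [hQ _ (by omega), twist_zero]⟩, fun _ => rfl⟩
  obtain ⟨Q₂, hQ₂⟩ : ∃ P : SuperPsiDO D, ∀ i, P.coeff i = D (Q.coeff i) :=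
    ⟨⟨fun i => D (Q.coeff i), N, fun i hi => by rw [hQ _ hi, map_zero]⟩, fun _ => rfl⟩
  have h₁ : Q₁.OrderLE (N + 1) := fun i hi => by rw [hQ₁, hQ _ (by omega), twist_zero]
  have h₂ : Q₂.OrderLE N := fun i hi => by rw [hQ₂, hQ _ hi, map_zero]
  have h : dpow 1 Q = Q₁ + Q₂ := by
    ext m
    rw [dpow_one_coeff, add_coeff, hQ₁, hQ₂]
  ext m
  have hsub : Icc (m - M) (N + 1) ⊆ (Icc (m - M - 1) N).map (addRightEmbedding 1) := by
    rw [map_add_right_Icc, sub_add_cancel]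
  rw [h, SuperPsiDO.add_mul, add_coeff, mul_coeff h₁ hR hsub, sum_map,
    mul_coeff h₂ hR (s := Icc (m - M - 1) N) (Icc_subset_Icc (by omega) le_rfl),
    dpow_one_coeff, mul_coeff hQ hR (s := Icc (m - M - 1) N) (Icc_subset_Icc (by omega) le_rfl),
    mul_coeff hQ hR (s := Icc (m - M - 1) N) (Icc_subset_Icc (by omega) le_rfl), twist_sum, map_sum,
    ← sum_add_distrib, ← sum_add_distrib]
  refine sum_congr rfl fun i _ => ?_
  rw [hQ₁, hQ₂, addRightEmbedding_apply, add_sub_cancel_right, dpow_add_one_coeff, D.leibniz,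
    twist_mul, mul_add]
  abel

/-- Positive powers iterate the case of `𝒟`; negative ones follow by cancelling a left factor `𝒟`.
-/
theorem dpow_mul (i : ℤ) (Q R : SuperPsiDO D) : dpow i (Q * R) = dpow i Q * R := by
  induction i with
  | zero => rw [dpow_zero, dpow_zero]
  | succ i ih => rw [dpow_add_one, ih, dpow_one_mul, ← dpow_add_one]
  | pred i ih =>
    apply dpow_one_injective
    rw [dpow_one_mul, ← dpow_add_one, ← dpow_add_one, sub_add_cancel, ih]

protected theorem mul_assoc (P Q R : SuperPsiDO D) : P * Q * R = P * (Q * R) := by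
  obtain ⟨N, hP⟩ := P.exists_orderLE
  obtain ⟨M, hQ⟩ := Q.exists_orderLE
  obtain ⟨L, hR⟩ := R.exists_orderLE
  ext m
  have key : ∀ i ∈ Icc (m - (M + L)) N, (dpow i (Q * R)).coeff m =
      ∑ j ∈ Icc (m - L) (N + M), (dpow i Q).coeff j * (dpow j R).coeff m := fun i hi => by
    rw [mem_Icc] at hi
    rw [dpow_mul, mul_coeff (hQ.dpow i) hR (s := Icc (m - L) (N + M))
      (Icc_subset_Icc le_rfl (by omega))]
  rw [mul_coeff hP (hQ.mul hR) subset_rfl, sum_congr rfl fun i hi => by rw [key i hi],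
    mul_coeff (hP.mul hQ) hR subset_rfl]
  simp only [mul_sum]
  rw [sum_comm]
  refine sum_congr rfl fun j hj => ?_
  rw [mem_Icc] at hj
  rw [mul_coeff hP hQ (s := Icc (m - (M + L)) N) (Icc_subset_Icc (by omega) le_rfl), sum_mul]
  exact sum_congr rfl fun i _ => mul_assoc _ _ _

protected theorem one_mul (P : SuperPsiDO D) : 1 * P = P := by
  ext m
  exact (monomial_mul_coeff 0 1 P m).trans (by rw [one_mul, dpow_zero])

theorem dpow_monomial_coeff (j i : ℤ) (a : A) (m : ℤ) :
    (dpow j (monomial D i a)).coeff m = (dpow j (monomial D 0 a)).coeff (m - i) := by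
  refine finsum_congr fun k => ?_
  rw [monomial_coeff, monomial_coeff]
  rw [if_congr (show m - j + k = i ↔ m - i - j + k = 0 by omega) rfl rfl]

theorem dpow_monomial_zero_coeff (j : ℤ) (a : A) (k : ℕ) :
    (dpow j (monomial D 0 a)).coeff (j - k) =
      superBinom j k • (D : A → A)^[k] (twist 𝒜 (j - k) a) := by
  refine (finsum_eq_single _ k fun l hl => ?_).trans ?_
  · rw [monomial_coeff, if_neg (by omega), twist_zero, iterate_zero_apply, smul_zero]
  · rw [monomial_coeff, if_pos (by omega)]

theorem mul_monomial_coeff (P : SuperPsiDO D) (i : ℤ) (a : A) (m : ℤ) :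
    (P * monomial D i a).coeff m = (P * monomial D 0 a).coeff (m - i) := by
  obtain ⟨N, hP⟩ := P.exists_orderLE
  rw [mul_coeff hP (orderLE_monomial i a) subset_rfl,
    mul_coeff hP (orderLE_monomial 0 a) (s := Icc (m - i) N) (by rw [sub_zero])]
  exact sum_congr rfl fun j _ => by rw [dpow_monomial_coeff]

theorem dpow_one_one (j : ℤ) : dpow j (1 : SuperPsiDO D) = monomial D j 1 := by
  ext m
  rw [monomial_coeff]
  rcases le_or_gt m j with h | h
  · obtain ⟨k, rfl⟩ : ∃ k : ℕ, m = j - k := ⟨(j - m).toNat, by omega⟩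
    refine (dpow_monomial_zero_coeff j 1 k).trans ?_
    cases k with
    | zero => simp [superBinom_zero_right]
    | succ k =>
      rw [twist_one_right, Function.iterate_succ_apply, D.map_one, iterate_zero_apply, smul_zero,
        if_neg (by push_cast; omega)]
  · rw [if_neg h.ne']
    exact (orderLE_monomial 0 1).dpow j m (by omega)

protected theorem mul_one (P : SuperPsiDO D) : P * 1 = P := by
  ext m
  obtain ⟨N, hP⟩ := P.exists_orderLE
  change (P * monomial D 0 1).coeff m = _
  rw [mul_coeff hP (orderLE_monomial 0 1) (s := insert m (Icc (m - 0) N)) (subset_insert _ _),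
    sum_eq_single m]
  · change _ * (dpow m 1).coeff m = _
    rw [dpow_one_one, monomial_coeff, if_pos rfl, mul_one]
  · intro j _ hj
    change _ * (dpow j 1).coeff m = _
    rw [dpow_one_one, monomial_coeff, if_neg hj.symm, mul_zero]
  · exact fun h => (h (mem_insert_self _ _)).elim

instance : Zero (SuperPsiDO D) := ⟨monomial D 0 0⟩

instance : Neg (SuperPsiDO D) := ⟨fun P =>
  { coeff := fun i => -P.coeff i
    bounded' := by
      obtain ⟨N, hN⟩ := P.bounded'
      exact ⟨N, fun i hi => by rw [hN i hi, neg_zero]⟩ }⟩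

@[simp]
theorem zero_coeff (i : ℤ) : (0 : SuperPsiDO D).coeff i = 0 := ite_self 0

theorem neg_coeff (P : SuperPsiDO D) (i : ℤ) : (-P).coeff i = -P.coeff i := rfl

theorem orderLE_zero (N : ℤ) : (0 : SuperPsiDO D).OrderLE N := fun i _ => zero_coeff i

/-- Super-pseudodifferential operators form a ring. -/
noncomputable instance : Ring (SuperPsiDO D) where
  add_assoc P Q R := SuperPsiDO.ext (funext fun _ => add_assoc _ _ _)
  zero_add P := SuperPsiDO.ext (funext fun i => by rw [add_coeff, zero_coeff, zero_add])
  add_zero P := SuperPsiDO.ext (funext fun i => by rw [add_coeff, zero_coeff, add_zero])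
  add_comm P Q := SuperPsiDO.ext (funext fun _ => add_comm _ _)
  neg_add_cancel P := SuperPsiDO.ext (funext fun i => by
    rw [add_coeff, neg_coeff, neg_add_cancel, zero_coeff])
  nsmul := nsmulRec
  zsmul := zsmulRec
  left_distrib := SuperPsiDO.mul_add
  right_distrib := SuperPsiDO.add_mul
  zero_mul P := by
    ext m
    obtain ⟨M, hM⟩ := P.exists_orderLE
    rw [mul_coeff (orderLE_zero (m - M - 1)) hM (s := ∅) (by rw [Icc_eq_empty (by omega)]),
      sum_empty, zero_coeff]
  mul_zero P := by
    ext m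
    obtain ⟨N, hN⟩ := P.exists_orderLE
    rw [mul_coeff hN (orderLE_zero (m - N - 1)) (s := ∅) (by rw [Icc_eq_empty (by omega)]),
      sum_empty, zero_coeff]
  mul_assoc := SuperPsiDO.mul_assoc
  one_mul := SuperPsiDO.one_mul
  mul_one := SuperPsiDO.mul_one

theorem sub_coeff (P Q : SuperPsiDO D) (i : ℤ) : (P - Q).coeff i = P.coeff i - Q.coeff i := by
  rw [sub_eq_add_neg, add_coeff, neg_coeff, sub_eq_add_neg]

/-- Powers are those of `npowRec`, unfolded by hand here and in `pow_succ_eq`. -/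
theorem pow_zero_eq (P : SuperPsiDO D) : P ^ 0 = 1 := rfl

theorem pow_succ_eq (P : SuperPsiDO D) (n : ℕ) : P ^ (n + 1) = P ^ n * P := rfl

end SuperPsiDO

end SuperSK

/-! ### Parity and differential polynomial coefficients -/

namespace SuperSK

section DiffPart

variable {K A : Type*} [Field K] [Ring A] [Algebra K A]
  {𝒜 : ZMod 2 → Submodule K A} [GradedAlgebra 𝒜] (D : OddDerivation 𝒜) {φ : A}

theorem twist_mem_diffPoly {p : ZMod 2} (hφ : φ ∈ 𝒜 p) (n : ℤ) {a : A} (ha : a ∈ diffPoly D φ) :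
    twist 𝒜 n a ∈ diffPoly D φ := by
  induction ha using Algebra.adjoin_induction with
  | mem x hx =>
    have hmem := Algebra.subset_adjoin (R := K) hx
    obtain ⟨k, rfl⟩ := hx
    have hk := D.iterate_mem k hφ
    generalize p + (k : ZMod 2) = q at hk
    fin_cases q
    · exact (twist_of_mem_zero n hk).symm ▸ hmem
    · exact (twist_of_mem_one n hk).symm ▸ zsmul_mem hmem _
  | algebraMap r =>
    rw [Algebra.algebraMap_eq_smul_one, twist_smul, twist_one_right]
    exact Subalgebra.smul_mem _ (one_mem _) r
  | add x y _ _ hx hy =>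
    rw [twist_add]
    exact add_mem hx hy
  | mul x y _ _ hx hy =>
    rw [twist_mul]
    exact mul_mem hx hy

theorem map_mem_diffPoly {p : ZMod 2} (hφ : φ ∈ 𝒜 p) {a : A} (ha : a ∈ diffPoly D φ) :
    D a ∈ diffPoly D φ := by
  induction ha using Algebra.adjoin_induction with
  | mem x hx =>
    obtain ⟨k, rfl⟩ := hx
    exact Algebra.subset_adjoin ⟨k + 1, Function.iterate_succ_apply' _ k φ⟩
  | algebraMap r =>
    rw [Algebra.algebraMap_eq_smul_one, map_smul, D.map_one, smul_zero]
    exact zero_mem _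
  | add x y _ _ hx hy => exact map_add D.toLinearMap x y ▸ add_mem hx hy
  | mul x y hx' hy' hx hy =>
    rw [D.leibniz]
    exact add_mem (mul_mem hx hy') (mul_mem (twist_mem_diffPoly D hφ 1 hx') hy)

/-- The differential polynomials in `φ` of parity `p`. -/
def diffPart (φ : A) (p : ZMod 2) : Submodule K A := 𝒜 p ⊓ (diffPoly D φ).toSubmodule

variable {D}

theorem mul_mem_diffPart {p q : ZMod 2} {a b : A} (ha : a ∈ diffPart D φ p)
    (hb : b ∈ diffPart D φ q) : a * b ∈ diffPart D φ (p + q) :=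
  ⟨SetLike.mul_mem_graded ha.1 hb.1, (diffPoly D φ).mul_mem ha.2 hb.2⟩

theorem twist_mem_diffPart {p : ZMod 2} (hφ : φ ∈ 𝒜 1) (n : ℤ) {a : A}
    (ha : a ∈ diffPart D φ p) : twist 𝒜 n a ∈ diffPart D φ p :=
  ⟨twist_mem n ha.1, twist_mem_diffPoly D hφ n ha.2⟩

theorem iterate_mem_diffPart {p : ZMod 2} (hφ : φ ∈ 𝒜 1) (k : ℕ) {a : A}
    (ha : a ∈ diffPart D φ p) : (D : A → A)^[k] a ∈ diffPart D φ (p + k) := by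
  refine ⟨D.iterate_mem k ha.1, ?_⟩
  induction k with
  | zero => exact ha.2
  | succ k ih =>
    rw [Function.iterate_succ_apply']
    exact map_mem_diffPoly D hφ ih

end DiffPart

namespace SuperPsiDO

open Finset

variable {K A : Type*} [Field K] [Ring A] [Algebra K A]
  {𝒜 : ZMod 2 → Submodule K A} [GradedAlgebra 𝒜] {D : OddDerivation 𝒜} {φ : A}

/-- `P` is homogeneous of parity `p`, and its coefficients are differential polynomials in `φ`. -/
def IsDiffHomogeneous (φ : A) (p : ZMod 2) (P : SuperPsiDO D) : Prop :=
  ∀ i : ℤ, P.coeff i ∈ diffPart D φ (p + i)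

namespace IsDiffHomogeneous

variable {p q : ZMod 2} {P Q : SuperPsiDO D}

theorem add (hP : P.IsDiffHomogeneous φ p) (hQ : Q.IsDiffHomogeneous φ p) :
    (P + Q).IsDiffHomogeneous φ p := fun i => add_mem (hP i) (hQ i)

theorem sub (hP : P.IsDiffHomogeneous φ p) (hQ : Q.IsDiffHomogeneous φ p) :
    (P - Q).IsDiffHomogeneous φ p := fun i => by
  rw [sub_coeff]
  exact sub_mem (hP i) (hQ i)

theorem monomial {i : ℤ} {a : A} (ha : a ∈ diffPart D φ (p + i)) :
    (monomial D i a).IsDiffHomogeneous φ p := fun j => by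
  rw [monomial_coeff]
  split_ifs with h
  · exact h ▸ ha
  · exact zero_mem _

theorem dpow (hφ : φ ∈ 𝒜 1) (hQ : Q.IsDiffHomogeneous φ q) (i : ℤ) :
    (dpow i Q).IsDiffHomogeneous φ (q + i) := fun m => by
  obtain ⟨M, hM⟩ := Q.exists_orderLE
  change dpowCoeff i Q m ∈ _
  rw [dpowCoeff_eq_sum hM (n := (M - m + i).toNat + 1) (by omega)]
  refine sum_mem fun k _ => zsmul_mem ?_ _
  have h := iterate_mem_diffPart hφ k (twist_mem_diffPart hφ (i - k) (hQ (m - i + k)))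
  convert h using 2
  push_cast
  have h2 : (2 : ZMod 2) = 0 := rfl
  linear_combination (i - k : ZMod 2) * h2

theorem mul (hφ : φ ∈ 𝒜 1) (hP : P.IsDiffHomogeneous φ p) (hQ : Q.IsDiffHomogeneous φ q) :
    (P * Q).IsDiffHomogeneous φ (p + q) := fun m => by
  obtain ⟨N, hN⟩ := P.exists_orderLE
  obtain ⟨M, hM⟩ := Q.exists_orderLE
  rw [mul_coeff hN hM subset_rfl]
  refine sum_mem fun i _ => ?_
  convert mul_mem_diffPart (hP i) (hQ.dpow hφ i m) using 2
  have h2 : (2 : ZMod 2) = 0 := rfl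
  linear_combination -(i : ZMod 2) * h2

end IsDiffHomogeneous

/-! ### Residues of supercommutators -/

/-- Only `𝒟^(-1)` contributes: `𝒟^j a` has order at most `j`, and has no `𝒟^(-1)` term when `j ≥ 0`.
-/
theorem sres_mul_monomial_zero (P : SuperPsiDO D) (a : A) :
    (P * monomial D 0 a).sres = P.coeff (-1) * twist 𝒜 1 a := by
  obtain ⟨N, hP⟩ := P.exists_orderLE
  have h1 := dpow_monomial_zero_coeff (D := D) (-1) a 0
  rw [Nat.cast_zero, sub_zero] at h1
  rw [sres, mul_coeff hP (orderLE_monomial 0 a) (s := insert (-1) (Icc (-1 - 0) N))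
    (subset_insert _ _), sum_eq_single (-1)]
  · rw [h1, superBinom_zero_right, one_smul, Function.iterate_zero_apply,
      show (-1 : ℤ) = -2 + 1 from rfl, ← twist_twist, twist_of_even (by decide)]
  · intro j hj hj'
    obtain ⟨n, rfl⟩ : ∃ n : ℕ, j = n := ⟨j.toNat, by
      rw [mem_insert, mem_Icc] at hj; omega⟩
    have h := dpow_monomial_zero_coeff (D := D) n a (n + 1)
    rw [superBinom_natCast_succ, zero_smul] at h
    rw [show (-1 : ℤ) = n - (n + 1 : ℕ) by push_cast; ring, h, mul_zero]
  · exact fun h => (h (mem_insert_self _ _)).elim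

theorem twist_of_mem {i n : ℤ} {a : A} (ha : a ∈ 𝒜 i) :
    twist 𝒜 n a = (((n * i).negOnePow : ℤˣ) : ℤ) • a := by
  have h2 : (2 : ZMod 2) = 0 := rfl
  rcases Int.even_or_odd' i with ⟨k, rfl | rfl⟩
  · have e : ((2 * k : ℤ) : ZMod 2) = 0 := by push_cast; linear_combination (k : ZMod 2) * h2
    rw [twist_of_mem_zero n (e ▸ ha), Int.negOnePow_even _ ((even_two_mul k).mul_left n),
      Units.val_one, one_smul]
  · have e : ((2 * k + 1 : ℤ) : ZMod 2) = 1 := by push_cast; linear_combination (k : ZMod 2) * h2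
    rw [twist_of_mem_one n (e ▸ ha), mul_add, mul_one, Int.negOnePow_add,
      Int.negOnePow_even _ ((even_two_mul k).mul_left n), one_mul]

/-- The super residue of `𝒟^i S` is `± S_{-1-i}` up to a total super derivative. -/
theorem exists_sres_dpow (hφ : φ ∈ 𝒜 1) {p : ZMod 2} {S : SuperPsiDO D}
    (hS : S.IsDiffHomogeneous φ p) (i : ℤ) :
    ∃ g ∈ diffPoly D φ, (dpow i S).sres = twist 𝒜 i (S.coeff (-1 - i)) + D g := by
  obtain ⟨M, hM⟩ := S.exists_orderLE
  -- Every term of the residue after the zeroth carries some `𝒟^(k+1)`; the witness removes one `𝒟`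
  -- from each.
  refine ⟨∑ k ∈ range (M + 1 + i).toNat, superBinom i (k + 1) • (D : A → A)^[k]
    (twist 𝒜 (i - (k + 1 : ℕ)) (S.coeff (-1 - i + (k + 1 : ℕ)))), sum_mem fun k _ =>
      zsmul_mem (iterate_mem_diffPart hφ k (twist_mem_diffPart hφ _ (hS _))).2 _, ?_⟩
  change dpowCoeff i S (-1) = _
  rw [dpowCoeff_eq_sum hM (n := (M + 1 + i).toNat + 1) (by omega), sum_range_succ', map_sum,
    add_comm]
  congr 1
  · simp [superBinom_zero_right]
  · refine sum_congr rfl fun k _ => ?_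
    rw [map_zsmul, Function.iterate_succ_apply']

theorem exists_sres_supercommutator_monomial (hA : IsSupercommutative 𝒜) (hφ : φ ∈ 𝒜 1)
    {S : SuperPsiDO D} (hS : S.IsDiffHomogeneous φ 1) (i : ℤ) {a : A}
    (ha : a ∈ diffPart D φ (1 + i)) :
    ∃ g ∈ diffPoly D φ, (monomial D i a * S).sres + (S * monomial D i a).sres = D g := by
  have h2 : (2 : ZMod 2) = 0 := rfl
  have hSa : (S * monomial D 0 a).IsDiffHomogeneous φ i := by
    have h0 : (monomial D 0 a).IsDiffHomogeneous φ (1 + i) := .monomial (by simpa using ha)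
    convert hS.mul hφ h0 using 1
    linear_combination -h2
  obtain ⟨g, hg, h⟩ := exists_sres_dpow hφ hSa i
  have hU := (hS.dpow hφ i (-1)).1
  rw [show 1 + (i : ZMod 2) + (-1 : ℤ) = i by push_cast; ring] at hU
  have hV := (hSa (-1 - i)).1
  rw [show (i : ZMod 2) + (-1 - i : ℤ) = (1 : ℤ) by push_cast; linear_combination -h2] at hV
  have ha' : a ∈ 𝒜 ((1 + i : ℤ) : ZMod 2) := by simpa using ha.1
  -- Evaluate the residue of `𝒟^i S a` from the left and from the right. The element `a` and the
  -- residue of `𝒟^i S` have opposite parities, so one is even and they commute.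
  rw [dpow_mul, sres_mul_monomial_zero, twist_of_mem ha', twist_of_mem hV, mul_smul_comm,
    ← mul_comm_of_mem hA ha.1 hU] at h
  refine ⟨((1 * (1 + i)).negOnePow : ℤ) • g, zsmul_mem hg _, ?_⟩
  have hu (n : ℤ) : ((n.negOnePow : ℤˣ) : ℤ) * ((n.negOnePow : ℤˣ) : ℤ) = 1 := by
    rw [← Units.val_mul, Int.units_mul_self, Units.val_one]
  have hi : (((1 * (1 + i)).negOnePow : ℤˣ) : ℤ) = -((i * 1).negOnePow : ℤˣ) := by
    rw [one_mul, mul_one, add_comm, Int.negOnePow_succ, Units.val_neg]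
  have h' := congrArg (fun x => (((1 * (1 + i)).negOnePow : ℤˣ) : ℤ) • x) h
  simp only [smul_smul, hu, one_smul, smul_add] at h'
  rw [hi, neg_mul, hu, neg_smul, one_smul, ← hi] at h'
  rw [sres, sres, monomial_mul_coeff, mul_monomial_coeff, map_zsmul, h']
  abel

/-- The super residue of the supercommutator of two odd operators is a total super derivative. -/
theorem exists_sres_supercommutator (hA : IsSupercommutative 𝒜) (hφ : φ ∈ 𝒜 1)
    {P S : SuperPsiDO D} (hP : P.IsDiffHomogeneous φ 1) (hS : S.IsDiffHomogeneous φ 1) :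
    ∃ g ∈ diffPoly D φ, (P * S).sres + (S * P).sres = D g := by
  obtain ⟨M, hM⟩ := S.exists_orderLE
  obtain ⟨N, hN⟩ := P.exists_orderLE
  -- Peel off the leading monomials of `P`. Once its order is at most `-2 - M`, both products have
  -- order at most `-2` and their residues vanish.
  suffices h : ∀ (n : ℕ) (P : SuperPsiDO D), P.IsDiffHomogeneous φ 1 →
      P.OrderLE (-2 - M + n) → ∃ g ∈ diffPoly D φ, (P * S).sres + (S * P).sres = D g from
    h (N + 2 + M).toNat P hP (hN.mono (by omega))
  intro n
  induction n with
  | zero =>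
    intro P _ hP
    refine ⟨0, zero_mem _, ?_⟩
    rw [sres, sres, hP.mul hM _ (by push_cast; omega), hM.mul hP _ (by push_cast; omega), add_zero,
      map_zero]
  | succ n ih =>
    intro P hP hord
    set j : ℤ := -2 - M + (n + 1 : ℕ) with hj
    obtain ⟨g, hg, h⟩ := exists_sres_supercommutator_monomial hA hφ hS j (hP j)
    obtain ⟨g', hg', h'⟩ := ih (P - monomial D j (P.coeff j)) (hP.sub (.monomial (hP j)))
      fun i hi => by
        rw [sub_coeff, monomial_coeff]
        split_ifs with hij
        · rw [hij, sub_self]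
        · rw [hord i (by push_cast at hj; omega), sub_zero]
    refine ⟨g + g', add_mem hg hg', ?_⟩
    rw [map_add, ← h, ← h', sub_mul, mul_sub]
    simp only [sres, sub_coeff]
    abel

end SuperPsiDO

end SuperSK

/-! ### Existence and uniqueness of cube roots -/

namespace SuperSK

namespace SuperPsiDO

variable {K A : Type*} [Field K] [Ring A] [Algebra K A]
  {𝒜 : ZMod 2 → Submodule K A} [GradedAlgebra 𝒜] {D : OddDerivation 𝒜} {φ : A}

theorem OrderLE.sub {P Q : SuperPsiDO D} {N : ℤ} (hP : P.OrderLE N) (hQ : Q.OrderLE N) :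
    (P - Q).OrderLE N := fun i hi => by rw [sub_coeff, hP i hi, hQ i hi, sub_zero]

/-- The linearization of the cube at an operator `𝒟^d + ⋯`, on leading coefficients. -/
theorem cube_sub_cube {X Y : SuperPsiDO D} {d j : ℤ} (hX : X.OrderLE d) (hY : Y.OrderLE d)
    (hX1 : X.coeff d = 1) (hY1 : Y.coeff d = 1) (hE : (X - Y).OrderLE j) :
    (X * X * X - Y * Y * Y).OrderLE (2 * d + j) ∧
      (X * X * X - Y * Y * Y).coeff (2 * d + j) =
        twist 𝒜 (2 * d) ((X - Y).coeff j) + twist 𝒜 d ((X - Y).coeff j) + (X - Y).coeff j := by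
  have e : X * X * X - Y * Y * Y = X * X * (X - Y) + X * (X - Y) * Y + (X - Y) * Y * Y := by
    noncomm_ring
  rw [e]
  generalize X - Y = E at hE
  constructor
  · exact ((((hX.mul hX).mul hE).mono (by omega)).add (((hX.mul hE).mul hY).mono (by omega))).add
      (((hE.mul hY).mul hY).mono (by omega))
  · have h1 := mul_coeff_top (hX.mul hX) hE
    have h2 := mul_coeff_top (hX.mul hE) hY
    have h3 := mul_coeff_top (hE.mul hY) hY
    rw [mul_coeff_top hX hX, hX1, twist_one_right, one_mul, one_mul,
      show d + d + j = 2 * d + j by ring] at h1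
    rw [mul_coeff_top hX hE, hX1, hY1, twist_one_right, one_mul, mul_one,
      show d + j + d = 2 * d + j by ring] at h2
    rw [mul_coeff_top hE hY, hY1, twist_one_right, mul_one, twist_one_right, mul_one,
      show j + d + d = 2 * d + j by ring] at h3
    rw [add_coeff, add_coeff, h1, h2, h3, two_mul d]

theorem eq_of_forall_orderLE {P Q : SuperPsiDO D} (c : ℤ) (h : ∀ n : ℕ, (P - Q).OrderLE (c - n)) :
    P = Q := by
  ext i
  rw [← sub_eq_zero, ← sub_coeff]
  exact h (c - i + 1).toNat i (by omega)

theorem cube_eq (P : SuperPsiDO D) : P ^ 3 = P * P * P := by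
  rw [pow_succ_eq, pow_succ_eq, pow_succ_eq, pow_zero_eq, one_mul]

theorem IsCubeRoot.eq [CharZero K] {P Q L : SuperPsiDO D} (hP : P.IsCubeRoot L)
    (hQ : Q.IsCubeRoot L) : P = Q := by
  refine eq_of_forall_orderLE 2 fun n => ?_
  induction n with
  | zero =>
    rw [Nat.cast_zero, sub_zero]
    exact OrderLE.sub hP.order_le hQ.order_le
  | succ n ih =>
    -- With `d = 2` both twists are trivial, so the equality of the cubes says that three times the
    -- top coefficient of `P - Q` is zero.
    have h := (cube_sub_cube hP.order_le hQ.order_le hP.leading hQ.leading ih).2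
    rw [← cube_eq, ← cube_eq, hP.cube, hQ.cube, sub_self, zero_coeff,
      twist_of_even (by decide), twist_of_even (by decide)] at h
    have h3 : (3 : K) • (P - Q).coeff (2 - n) = 0 := by
      rw [h, show (3 : K) = 1 + 1 + 1 by norm_num, add_smul, add_smul, one_smul]
    have h0 := (smul_eq_zero_iff_right (three_ne_zero (α := K))).1 h3
    intro i hi
    rcases eq_or_ne i (2 - n) with rfl | hne
    · exact h0
    · exact ih i (by push_cast at hi; omega)

/-- Improving an approximate cube root of an odd operator `𝒟³ + ⋯` by one order. -/
theorem exists_cube_correction [CharZero K] (hφ : φ ∈ 𝒜 1) {L : SuperPsiDO D}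
    (hL : L.IsDiffHomogeneous φ 1) {j : ℤ} (hj : j < 1) {R : SuperPsiDO D}
    (hR : R.IsDiffHomogeneous φ 1) (hR1 : R.OrderLE 1) (hR2 : R.coeff 1 = 1)
    (hRL : (R * R * R - L).OrderLE (2 + j)) :
    ∃ R' : SuperPsiDO D, R'.IsDiffHomogeneous φ 1 ∧ R'.OrderLE 1 ∧ R'.coeff 1 = 1 ∧
      (R' * R' * R' - L).OrderLE (2 + j - 1) ∧ (R' - R).OrderLE j := by
  have h2 : (2 : ZMod 2) = 0 := rfl
  set r := (R * R * R - L).coeff (2 + j) with hr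
  have hrm : r ∈ diffPart D φ (1 + j) := by
    convert ((hR.mul hφ hR).mul hφ hR).sub hL (2 + j) using 2
    push_cast
    linear_combination -2 * h2
  -- With `σ = twist 𝒜 1`, this solves `2e + σe = -r`, using `σ² = 1`.
  set e : A := (3 : K)⁻¹ • (twist 𝒜 1 r - (2 : K) • r) with he
  have hσe : twist 𝒜 1 e = (3 : K)⁻¹ • (r - (2 : K) • twist 𝒜 1 r) := by
    have hσ : twist 𝒜 1 (twist 𝒜 1 r) = r := by
      rw [twist_twist]
      exact twist_of_even (by decide) r
    rw [he, ← twistLinear_apply, map_smul, map_sub, map_smul, twistLinear_apply, twistLinear_apply,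
      hσ]
  have hem : e ∈ diffPart D φ (1 + j) := Submodule.smul_mem _ _
    (sub_mem (twist_mem_diffPart hφ 1 hrm) (Submodule.smul_mem _ _ hrm))
  have hR'1 : (R + monomial D j e).OrderLE 1 := hR1.add ((orderLE_monomial j e).mono hj.le)
  have hR'2 : (R + monomial D j e).coeff 1 = 1 := by
    rw [add_coeff, hR2, orderLE_monomial j e 1 hj, add_zero]
  have hE : (R + monomial D j e - R).OrderLE j := by
    rw [add_sub_cancel_left]
    exact orderLE_monomial j e
  obtain ⟨h1, h2⟩ := cube_sub_cube hR'1 hR1 hR'2 hR2 hE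
  refine ⟨R + monomial D j e, hR.add (.monomial hem), hR'1, hR'2, fun i hi => ?_, hE⟩
  rw [mul_one] at h1 h2
  rw [← sub_add_sub_cancel _ (R * R * R) L, add_coeff]
  rcases eq_or_ne i (2 + j) with hij | hne
  · rw [hij, h2, ← hr, add_sub_cancel_left, monomial_coeff, if_pos rfl, twist_of_even even_two,
      hσe, he]
    match_scalars <;> norm_num
  · rw [h1 i (by omega), hRL i (by omega), add_zero]

theorem exists_odd_cube_root [CharZero K] (hφ : φ ∈ 𝒜 1) :
    ∃ R : SuperPsiDO D, R.IsDiffHomogeneous φ 1 ∧ R.OrderLE 1 ∧ R.coeff 1 = 1 ∧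
      R * R * R = monomial D 3 1 + monomial D 0 φ := by
  have h1 : (1 : A) ∈ diffPart D φ 0 := ⟨one_mem_even, (diffPoly D φ).one_mem⟩
  have hφ' : φ ∈ diffPart D φ 1 := ⟨hφ, Algebra.subset_adjoin ⟨0, rfl⟩⟩
  set L : SuperPsiDO D := monomial D 3 1 + monomial D 0 φ with hLdef
  have hL : L.IsDiffHomogeneous φ 1 := .add (.monomial h1) (.monomial (by simpa using hφ'))
  let Good (n : ℕ) (R : SuperPsiDO D) : Prop := R.IsDiffHomogeneous φ 1 ∧ R.OrderLE 1 ∧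
    R.coeff 1 = 1 ∧ (R * R * R - L).OrderLE (2 - n)
  have h0 : Good 0 (monomial D 1 1) := by
    refine ⟨.monomial h1, orderLE_monomial 1 1, by rw [monomial_coeff, if_pos rfl], ?_⟩
    have hc : monomial D 1 1 * monomial D 1 1 * monomial D 1 1 = monomial D 3 1 := by
      have hm (i j : ℤ) : monomial D i 1 * monomial D j 1 = monomial D (i + j) 1 := by
        ext m
        rw [monomial_one_mul, dpow_monomial_coeff]
        change (dpow i 1).coeff (m - j) = _
        rw [dpow_one_one, monomial_coeff, monomial_coeff]
        exact if_congr (by omega) rfl rfl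
      rw [hm, hm]
      rfl
    rw [hc, hLdef, sub_add_cancel_left]
    intro i hi
    rw [neg_coeff, orderLE_monomial 0 φ i (by push_cast at hi; omega), neg_zero]
  have hstep (n : ℕ) (R : {R // Good n R}) :
      ∃ R' : {R // Good (n + 1) R}, (R'.1 - R.1).OrderLE (-n) := by
    obtain ⟨R, h1, h2, h3, h4⟩ := R
    obtain ⟨R', k1, k2, k3, k4, k5⟩ := exists_cube_correction hφ hL (j := -n) (by omega) h1 h2 h3
      (by rwa [← sub_eq_add_neg])
    refine ⟨⟨R', k1, k2, k3, ?_⟩, k5⟩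
    convert k4 using 1
    push_cast
    ring
  choose f hf using hstep
  let S (n : ℕ) : {R // Good n R} := Nat.rec ⟨_, h0⟩ f n
  have hS (m n : ℕ) (hmn : m ≤ n) : ((S n).1 - (S m).1).OrderLE (-m) := by
    induction n, hmn using Nat.le_induction with
    | base =>
      rw [sub_self]
      exact orderLE_zero _
    | succ n hmn ih =>
      rw [← sub_add_sub_cancel _ (S n).1]
      exact ((hf n (S n)).mono (by omega)).add ih
  have hS' (m n : ℕ) (hmn : m ≤ n) (i : ℤ) (hi : -m < i) : (S n).1.coeff i = (S m).1.coeff i := by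
    rw [← sub_eq_zero, ← sub_coeff]
    exact hS m n hmn i hi
  -- The limit of the approximations: the coefficient of `𝒟^i` is stable from index `1 - i` on.
  let R : SuperPsiDO D := ⟨fun i => (S (1 - i).toNat).1.coeff i, 1, fun i hi => (S _).2.2.1 i hi⟩
  have hRc (i : ℤ) : R.coeff i = (S (1 - i).toNat).1.coeff i := rfl
  have hR1 : R.OrderLE 1 := fun i hi => (S _).2.2.1 i hi
  have hR2 : R.coeff 1 = 1 := (hRc 1).trans (S _).2.2.2.1
  refine ⟨R, fun i => (S _).2.1 i, hR1, hR2, eq_of_forall_orderLE 2 fun n => ?_⟩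
  have hE : (R - (S n).1).OrderLE (-n) := fun i hi => by
    rw [sub_coeff, hRc, sub_eq_zero]
    rcases le_total n (1 - i).toNat with h | h
    · exact hS' _ _ h i hi
    · exact (hS' _ _ h i (by omega)).symm
  rw [← sub_add_sub_cancel _ ((S n).1 * (S n).1 * (S n).1)]
  exact ((cube_sub_cube hR1 (S n).2.2.1 hR2 (S n).2.2.2.1 hE).1.mono (by omega)).add (S n).2.2.2.2

theorem sq_pow_succ (R : SuperPsiDO D) (n : ℕ) :
    (R * R) ^ (n + 1) = R * R ^ (2 * n + 1) ∧ (R * R) ^ (n + 1) = R ^ (2 * n + 1) * R := by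
  have hc (k : ℕ) : R * R ^ k = R ^ k * R := by
    induction k with
    | zero => rw [pow_zero_eq, mul_one, one_mul]
    | succ k ih => rw [pow_succ_eq, ← mul_assoc, ih]
  refine (and_iff_right_of_imp fun h => h.trans (hc _).symm).2 ?_
  induction n with
  | zero => rw [pow_succ_eq, pow_zero_eq, one_mul, mul_zero, pow_succ_eq, pow_zero_eq, one_mul]
  | succ n ih =>
    rw [pow_succ_eq, ih, show 2 * (n + 1) + 1 = 2 * n + 1 + 1 + 1 by ring, pow_succ_eq R (_ + 1),
      pow_succ_eq R (_ + 1), ← mul_assoc]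

theorem IsDiffHomogeneous.odd_pow (hφ : φ ∈ 𝒜 1) {R : SuperPsiDO D}
    (hR : R.IsDiffHomogeneous φ 1) (n : ℕ) : (R ^ (2 * n + 1)).IsDiffHomogeneous φ 1 := by
  induction n with
  | zero =>
    rw [mul_zero, pow_succ_eq, pow_zero_eq, one_mul]
    exact hR
  | succ n ih =>
    rw [show 2 * (n + 1) + 1 = 2 * n + 1 + 1 + 1 by ring, pow_succ_eq R (_ + 1),
      pow_succ_eq R (2 * n + 1)]
    have h := (ih.mul hφ hR).mul hφ hR
    rwa [show (1 : ZMod 2) + 1 + 1 = 1 from rfl] at h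

end SuperPsiDO

end SuperSK

/-! ### The main theorem -/

theorem mainTheorem1 {K A : Type*} [Field K] [CharZero K] [Ring A] [Algebra K A]
    (𝒜 : ZMod 2 → Submodule K A) [GradedAlgebra 𝒜] (hA : SuperSK.IsSupercommutative 𝒜)
    (D : SuperSK.OddDerivation 𝒜) (φ : A) (hφ : φ ∈ 𝒜 1) :
    (∃! Q : SuperSK.SuperPsiDO D, Q.IsCubeRoot (SuperSK.SuperPsiDO.laxOperator D φ)) ∧
      ∀ Q : SuperSK.SuperPsiDO D, Q.IsCubeRoot (SuperSK.SuperPsiDO.laxOperator D φ) →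
        ∀ n : ℕ, ∃ g ∈ SuperSK.diffPoly D φ, (Q ^ n).sres = D g := by
  obtain ⟨R, hR, hR1, hR2, hR3⟩ := SuperSK.SuperPsiDO.exists_odd_cube_root (D := D) hφ
  have hRR : (R * R).IsCubeRoot (SuperSK.SuperPsiDO.laxOperator D φ) := by
    refine ⟨?_, ?_, hR1.mul hR1⟩
    · rw [SuperSK.SuperPsiDO.cube_eq, SuperSK.SuperPsiDO.laxOperator, ← hR3]
      simp only [mul_assoc]
    · have h := SuperSK.SuperPsiDO.mul_coeff_top hR1 hR1
      rwa [hR2, SuperSK.twist_one_right, one_mul] at h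
  refine ⟨⟨R * R, hRR, fun Q hQ => hQ.eq hRR⟩, fun Q hQ n => ?_⟩
  obtain rfl := hQ.eq hRR
  cases n with
  | zero =>
    refine ⟨0, zero_mem _, ?_⟩
    rw [map_zero]
    exact SuperSK.SuperPsiDO.monomial_coeff 0 1 (-1)
  | succ n =>
    obtain ⟨g, hg, h⟩ :=
      SuperSK.SuperPsiDO.exists_sres_supercommutator hA hφ hR (hR.odd_pow hφ n)
    rw [← (R.sq_pow_succ n).1, ← (R.sq_pow_succ n).2] at h
    -- Both halves of the supercommutator equal `(R²)^(n+1)`, so `𝒟 g` is twice the residue.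
    refine ⟨(2 : K)⁻¹ • g, Subalgebra.smul_mem _ hg _, ?_⟩
    rw [map_smul, ← h, ← two_smul K, smul_smul, inv_mul_cancel₀ two_ne_zero, one_smul]
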